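/- Let $n\ge 2$ and let $C\subset\mathbb{R}^n$ be a closed convex cone with apex at the origin that is pointed ($C\cap(-C)=\{0\}$) and has nonempty interior. A set $A$ is called $C$-coconvex if $A=C\setminus K$ for some closed convex set $K\subset C$ and its Lebesgue measure $V_n(A)$ is positive and finite. For subsets $A,B\subset C$ define the co-sum $A\oplus B := C\setminus\big((C\setminus A)+(C\setminus B)\big)$, where $+$ is Minkowski addition, and for $\mu\ge 0$ put $\mu A=\{\mu a : a\in A\}$. Let $A_0,A_1$ be $C$-coconvex sets and let $\lambda\in(0,1)$. Then $(1-\lambda)A_0\oplus\lambda A_1$ has finite volume and $$V_n\big((1-\lambda)A_0\oplus\lambda A_1\big)^{1/n}\le(1-\lambda)V_n(A_0)^{1/n}+\lambda V_n(A_1)^{1/n}.$$ Equality holds if and only if $A_0=\alpha A_1$ for some $\alpha>0$. -/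

import Mathlib

open MeasureTheory
open scoped Pointwise

/-- `A` is a `C`-coconvex set: `A = C \ K` for some closed convex set `K ⊆ C`, and `A` has
positive finite Lebesgue measure. -/
def IsCoconvex {n : ℕ} (C : ProperCone ℝ (EuclideanSpace ℝ (Fin n)))
    (A : Set (EuclideanSpace ℝ (Fin n))) : Prop :=
  (∃ K : Set (EuclideanSpace ℝ (Fin n)),
    K ⊆ (C : Set (EuclideanSpace ℝ (Fin n))) ∧ IsClosed K ∧ Convex ℝ K ∧
      A = (C : Set (EuclideanSpace ℝ (Fin n))) \ K) ∧
  0 < volume A ∧ volume A < ⊤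

/-- The co-sum `A ⊕ B` relative to the cone `C`: the complement in `C` of the Minkowski sum
`(C \ A) + (C \ B)`. -/
def cosum {n : ℕ} (C : ProperCone ℝ (EuclideanSpace ℝ (Fin n)))
    (A B : Set (EuclideanSpace ℝ (Fin n))) : Set (EuclideanSpace ℝ (Fin n)) :=
  (C : Set (EuclideanSpace ℝ (Fin n))) \
    (((C : Set (EuclideanSpace ℝ (Fin n))) \ A) + ((C : Set (EuclideanSpace ℝ (Fin n))) \ B))

open Filter Topology Module

section ConeStable

variable {E : Type*} [NormedAddCommGroup E] [NormedSpace ℝ E]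

/-! ### Functions with comparable increments -/

/-! Finite volume of `C \ K` forces `K + C ⊆ K`. Fix `u` interior to `C` and let `h_K x` be the
least `r` with `x + r • u ∈ K`; this is a convex function, and slicing along `u` gives `V(C \ K) = ∫
(h_K - h_C)` over a complementary hyperplane. A point of `C` outside `(1-t)K₀ + tK₁` satisfies
`(1-t)h_{K₀} + t h_{K₁} > 0`, so the volume of the complement is at most the weighted mean of the
two volumes (`measure_sdiff_combination`). Rescaling both sets to volume 1 and using homogeneity of
degree `n` turns this into the stated inequality.

In the equality case `(1-t)h_{K₀} + t h_{K₁}` is bounded by its own infimal convolution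
(`le_combination_of_measure_le`). Convexity then makes `h_{K₀} - h_{K₁}` constant, and the constant
vanishes because the hyperplane has infinite measure. -/

lemma sub_le_sub_of_forall_increment_le {f g : E → ℝ} (hg : Continuous g)
    (h : ∀ y w, g y - g (y - w) ≤ f (y + w) - f y) (y v : E) :
    g (y + v) - g y ≤ f (y + v) - f y := by
  -- Summing the hypothesis over `k` equal steps leaves `g` one step behind `f`; the lag vanishes as
  -- the step tends to 0.
  have tele : ∀ (w : E) (k : ℕ),
      g (y + (k : ℝ) • w - w) - g (y - w) ≤ f (y + (k : ℝ) • w) - f y := by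
    intro w k
    induction k with
    | zero => simp
    | succ k ih =>
      have hk := h (y + (k : ℝ) • w) w
      have e1 : y + ((k + 1 : ℕ) : ℝ) • w - w = y + (k : ℝ) • w := by
        push_cast; module
      have e2 : y + ((k + 1 : ℕ) : ℝ) • w = y + (k : ℝ) • w + w := by
        push_cast; module
      rw [e1, e2]
      linarith
  have hw : Tendsto (fun N : ℕ => (1 / ((N : ℝ) + 1)) • v) atTop (𝓝 0) := by
    simpa using (tendsto_one_div_add_atTop_nhds_zero_nat (𝕜 := ℝ)).smul_const v
  have hlim : Tendsto (fun N : ℕ => g (y + v - (1 / ((N : ℝ) + 1)) • v)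
      - g (y - (1 / ((N : ℝ) + 1)) • v)) atTop (𝓝 (g (y + v - 0) - g (y - 0))) :=
    ((hg.tendsto _).comp (hw.const_sub (y + v))).sub ((hg.tendsto _).comp (hw.const_sub y))
  rw [sub_zero, sub_zero] at hlim
  refine le_of_tendsto hlim (Eventually.of_forall fun N => ?_)
  have hN := tele ((1 / ((N : ℝ) + 1)) • v) (N + 1)
  have hne : (N : ℝ) + 1 ≠ 0 := by positivity
  have e : ((N + 1 : ℕ) : ℝ) • (1 / ((N : ℝ) + 1)) • v = v := by
    rw [smul_smul]
    push_cast
    rw [mul_one_div_cancel hne, one_smul]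
  rwa [e] at hN

lemma sub_eq_sub_of_forall_increment_le {f g : E → ℝ} (hg : Continuous g)
    (h : ∀ y w, g y - g (y - w) ≤ f (y + w) - f y) (x y : E) :
    f x - g x = f y - g y := by
  have h1 := sub_le_sub_of_forall_increment_le hg h x (y - x)
  have h2 := sub_le_sub_of_forall_increment_le hg h y (x - y)
  rw [add_sub_cancel] at h1 h2
  linarith

/-- If the infimal convolution of two convex functions (with weights) equals their weighted sum,
the functions differ by a constant. -/
lemma ConvexOn.sub_eq_sub_of_le_combination {f g : E → ℝ} (hf : ConvexOn ℝ Set.univ f)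
    (hg : ConvexOn ℝ Set.univ g) (hgc : Continuous g) {t : ℝ} (ht₀ : 0 < t) (ht₁ : t < 1)
    (h : ∀ a b, (1 - t) * f ((1 - t) • a + t • b) + t * g ((1 - t) • a + t • b)
      ≤ (1 - t) * f a + t * g b) (x y : E) : f x - g x = f y - g y := by
  refine sub_eq_sub_of_forall_increment_le hgc (fun y w => ?_) x y
  -- These points average to `y`, and each lies on a segment from `y` on which convexity bounds `f`
  -- or `g`.
  have h1 := h (y + t • w) (y - (1 - t) • w)
  have e : (1 - t) • (y + t • w) + t • (y - (1 - t) • w) = y := by module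
  rw [e] at h1
  have h2 := hf.2 (Set.mem_univ y) (Set.mem_univ (y + w)) (sub_pos.2 ht₁).le ht₀.le (by ring)
  have h3 := hg.2 (Set.mem_univ y) (Set.mem_univ (y - w)) ht₀.le (sub_pos.2 ht₁).le (by ring)
  have e2 : (1 - t) • y + t • (y + w) = y + t • w := by module
  have e3 : t • y + (1 - t) • (y - w) = y - (1 - t) • w := by module
  rw [e2] at h2
  rw [e3] at h3
  simp only [smul_eq_mul] at h2 h3
  have h4 : 0 ≤ t * (1 - t) * ((f (y + w) - f y) - (g y - g (y - w))) := by
    nlinarith [mul_le_mul_of_nonneg_left h2 (sub_pos.2 ht₁).le,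
      mul_le_mul_of_nonneg_left h3 ht₀.le]
  have h5 := nonneg_of_mul_nonneg_right h4 (mul_pos ht₀ (sub_pos.2 ht₁))
  linarith

/-! ### Disintegration of Haar measure along a line -/

/-- A functional `l` with `l u = 1` splits `E` as `ℝ × l.ker`; uniqueness of Haar measure leaves a
scalar, which is absorbed into `ν`. -/
lemma MeasureTheory.Measure.exists_addHaar_eq_lintegral_line [FiniteDimensional ℝ E]
    [MeasurableSpace E] [BorelSpace E] (μ : Measure E) [μ.IsAddHaarMeasure] {u : E} (hu : u ≠ 0) :
    ∃ (W : Submodule ℝ E) (ν : Measure W), ν.IsAddHaarMeasure ∧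
      finrank ℝ W + 1 = finrank ℝ E ∧
      ∀ s, MeasurableSet s → μ s = ∫⁻ y : W, volume {r : ℝ | (y : E) + r • u ∈ s} ∂ν := by
  obtain ⟨l, hl⟩ := SeparatingDual.exists_eq_one (R := ℝ) hu
  let j : ℝ →L[ℝ] E := ContinuousLinearMap.toSpanSingleton ℝ u
  have hj : Function.RightInverse j l := fun r => by simp [j, hl]
  let e := ContinuousLinearEquiv.equivOfRightInverse l j hj
  let ν₀ : Measure l.ker := Measure.addHaar
  have he : ∀ (r : ℝ) (y : l.ker), e.symm (r, y) = (y : E) + r • u := by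
    intro r y
    rw [ContinuousLinearEquiv.symm_apply_eq]
    apply Prod.ext
    · simp [e, hl]
    · apply Subtype.ext
      simp [e, j, hl]
  let m := ((volume : Measure ℝ).prod ν₀).map e.symm
  have hm : m.IsAddHaarMeasure := e.symm.isAddHaarMeasure_map _
  obtain ⟨c, hc, hμ⟩ : ∃ c : NNReal, 0 < c ∧ μ = c • m :=
    ⟨_, Measure.addHaarScalarFactor_pos_of_isAddHaarMeasure μ m,
      Measure.isAddLeftInvariant_eq_smul μ m⟩
  refine ⟨l.ker, c • ν₀, ?_, ?_, ?_⟩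
  · exact Measure.IsAddHaarMeasure.smul (c := (c : ENNReal)) ν₀
      (by exact_mod_cast hc.ne') ENNReal.coe_ne_top
  · have := e.toLinearEquiv.finrank_eq
    rw [Module.finrank_prod, Module.finrank_self] at this
    omega
  · intro s hs
    rw [hμ, lintegral_smul_measure, Measure.smul_apply]
    congr 1
    rw [Measure.map_apply e.symm.continuous.measurable hs,
      Measure.prod_apply_symm (e.symm.continuous.measurable hs)]
    simp only [Set.preimage, he, Set.mem_ofPred_eq]

/-! ### Interior directions of a cone -/

lemma ProperCone.exists_add_smul_mem {C : ProperCone ℝ E} {u : E}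
    (hu : u ∈ interior (C : Set E)) (y : E) : ∃ r : ℝ, y + r • u ∈ C := by
  have hlim : Tendsto (fun s : ℝ => u + s • y) (𝓝[>] 0) (𝓝 u) := by
    have : Continuous (fun s : ℝ => u + s • y) := by fun_prop
    simpa using (this.tendsto 0).mono_left nhdsWithin_le_nhds
  obtain ⟨s, hs, hs0⟩ := ((hlim.eventually (mem_interior_iff_mem_nhds.1 hu)).and
    self_mem_nhdsWithin).exists
  have hs0 : 0 < s := hs0
  refine ⟨s⁻¹, ?_⟩
  have := C.smul_mem hs (inv_pos.2 hs0).le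
  rwa [smul_add, smul_smul, inv_mul_cancel₀ hs0.ne', one_smul, add_comm] at this

lemma ProperCone.exists_le_of_add_smul_mem {C : ProperCone ℝ E} {u : E} (hu : -u ∉ C) (y : E) :
    ∃ m : ℝ, ∀ r : ℝ, y + r • u ∈ C → m ≤ r := by
  have hlim : Tendsto (fun s : ℝ => -u + s • y) (𝓝 0) (𝓝 (-u)) := by
    have : Continuous (fun s : ℝ => -u + s • y) := by fun_prop
    simpa using this.tendsto 0
  obtain ⟨ε, hε, h⟩ := Metric.eventually_nhds_iff.1
    (hlim.eventually (C.isClosed.isOpen_compl.mem_nhds hu))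
  refine ⟨-ε⁻¹, fun r hr => ?_⟩
  by_contra! hlt
  have hr0 : 0 < -r := by linarith [inv_pos.2 hε]
  refine h (y := (-r)⁻¹) ?_ ?_
  · rw [Real.dist_eq, sub_zero, abs_of_pos (inv_pos.2 hr0)]
    exact inv_lt_of_inv_lt₀ hε (by linarith)
  · have := C.smul_mem hr (inv_pos.2 hr0).le
    have e : (-r)⁻¹ • (y + r • u) = -u + (-r)⁻¹ • y := by
      rw [smul_add, smul_smul, inv_neg, neg_mul, inv_mul_cancel₀ (neg_pos.1 hr0).ne]
      module
    rwa [e] at this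

lemma ProperCone.smul_set_eq (C : ProperCone ℝ E) {a : ℝ} (ha : 0 < a) :
    a • (C : Set E) = C := by
  ext x
  rw [Set.mem_smul_set_iff_inv_smul_mem₀ ha.ne']
  refine ⟨fun h => ?_, fun h => C.smul_mem h (inv_pos.2 ha).le⟩
  have := C.smul_mem h ha.le
  rwa [smul_inv_smul₀ ha.ne'] at this

/-! ### Closed convex sets having a given cone in their recession cone -/

/-- Nonempty closed convex subsets of `C` that are stable under adding elements of `C`. -/
structure IsConeStable (C : ProperCone ℝ E) (K : Set E) : Prop where
  subset : K ⊆ C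
  isClosed : IsClosed K
  convex : Convex ℝ K
  nonempty : K.Nonempty
  add_mem : ∀ k ∈ K, ∀ c ∈ C, k + c ∈ K

lemma ProperCone.isConeStable (C : ProperCone ℝ E) : IsConeStable C (C : Set E) where
  subset := subset_rfl
  isClosed := C.isClosed
  convex := C.convex
  nonempty := C.nonempty
  add_mem _ hk _ hc := AddMemClass.add_mem hk hc

lemma IsConeStable.smul {C : ProperCone ℝ E} {K : Set E} (hK : IsConeStable C K) {a : ℝ}
    (ha : 0 < a) : IsConeStable C (a • K) where
  subset := by
    rw [← C.smul_set_eq ha]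
    exact Set.smul_set_mono hK.subset
  isClosed := hK.isClosed.smul_of_ne_zero ha.ne'
  convex := hK.convex.smul a
  nonempty := hK.nonempty.smul_set
  add_mem := by
    rintro _ ⟨k, hk, rfl⟩ c hc
    refine ⟨k + a⁻¹ • c, hK.add_mem k hk _ (C.smul_mem hc (inv_pos.2 ha).le), ?_⟩
    simp only [smul_add, smul_inv_smul₀ ha.ne']

/-- `A` contains translates of every dilate `s • U` with `s ≥ 1`, whose measure is unbounded. -/
lemma measure_sdiff_eq_top_of_ray [FiniteDimensional ℝ E] [MeasurableSpace E] [BorelSpace E]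
    [Nontrivial E] (μ : Measure E) [μ.IsAddHaarMeasure] {A U : Set E} (hU : IsOpen U)
    (hne : U.Nonempty) (k : E) (h : ∀ b ∈ U, ∀ s : ℝ, 1 ≤ s → k + s • b ∈ A) : μ A = ⊤ := by
  have hpos : 0 < μ U := hU.measure_pos μ hne
  have hle : ∀ s : ℝ, 1 ≤ s → ENNReal.ofReal s * μ U ≤ μ A := by
    intro s hs
    have hsub : (fun x => k + x) '' (s • U) ⊆ A := by
      rintro _ ⟨_, ⟨b, hb, rfl⟩, rfl⟩
      exact h b hb s hs
    refine le_trans ?_ (measure_mono hsub)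
    rw [Set.image_add_left, measure_preimage_add, Measure.addHaar_smul,
      abs_of_nonneg (by positivity)]
    gcongr
    exact le_self_pow₀ hs (finrank_pos (R := ℝ) (M := E)).ne'
  have hlim : Tendsto (fun s : ℝ => ENNReal.ofReal s * μ U) atTop (𝓝 (⊤ * μ U)) :=
    ENNReal.Tendsto.mul_const ENNReal.tendsto_ofReal_atTop (Or.inl ENNReal.top_ne_zero)
  rw [ENNReal.top_mul hpos.ne'] at hlim
  exact top_le_iff.1 (le_of_tendsto hlim ((eventually_ge_atTop 1).mono hle))

lemma IsConeStable.of_measure_sdiff_lt_top [FiniteDimensional ℝ E] [MeasurableSpace E]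
    [BorelSpace E] [Nontrivial E] (μ : Measure E) [μ.IsAddHaarMeasure] {C : ProperCone ℝ E}
    (hint : (interior (C : Set E)).Nonempty) {K : Set E} (hsub : K ⊆ C) (hcl : IsClosed K)
    (hconv : Convex ℝ K) (hfin : μ ((C : Set E) \ K) < ⊤) : IsConeStable C K where
  subset := hsub
  isClosed := hcl
  convex := hconv
  nonempty := by
    by_contra hK
    rw [Set.not_nonempty_iff_eq_empty] at hK
    refine hfin.ne (measure_sdiff_eq_top_of_ray μ isOpen_interior hint 0 fun b hb s hs => ?_)
    rw [hK, Set.sdiff_empty, zero_add]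
    exact C.smul_mem (interior_subset hb) (by linarith)
  add_mem := by
    intro k hk c hc
    -- If `k + b ∉ K`, convexity keeps the rest of the ray from `k` through `k + b` outside `K`; an
    -- open set of such `b` would give `C \ K` infinite volume.
    have key : interior (C : Set E) ⊆ {c | k + c ∈ K} := by
      intro c hc
      by_contra hkc
      have hopen : IsOpen ((fun x => k + x) ⁻¹' Kᶜ) :=
        hcl.isOpen_compl.preimage (by fun_prop)
      refine hfin.ne (measure_sdiff_eq_top_of_ray μ (isOpen_interior.inter hopen)
        ⟨c, hc, hkc⟩ k ?_)
      rintro b ⟨hb, hkb⟩ s hs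
      have hs0 : 0 < s := by linarith
      refine ⟨AddMemClass.add_mem (hsub hk) (C.smul_mem (interior_subset hb) hs0.le), fun hks => hkb ?_⟩
      have := hconv.add_smul_mem hk hks (t := s⁻¹) ⟨(inv_pos.2 hs0).le, inv_le_one_of_one_le₀ hs⟩
      rwa [inv_smul_smul₀ hs0.ne'] at this
    have hclosed : IsClosed {c | k + c ∈ K} := hcl.preimage (f := fun x => k + x) (by fun_prop)
    have := closure_minimal key hclosed
    rw [C.convex.closure_interior_eq_closure_of_nonempty_interior hint] at this
    exact this (subset_closure hc)

/-! ### The height function of a set in a direction -/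

/-- The first parameter at which the line through `x` with direction `u` meets `K`. -/
noncomputable def heightAlong (u : E) (K : Set E) (x : E) : ℝ := sInf {r : ℝ | x + r • u ∈ K}

namespace IsConeStable

variable {C : ProperCone ℝ E} {K K₀ K₁ : Set E} {u : E}

/-- The parameters `r` form a closed ray: nonempty as `u` is interior, bounded below as `-u ∉ C`,
upward closed as `u ∈ C`. -/
lemma heightAlong_le_iff (hK : IsConeStable C K) (hu : u ∈ interior (C : Set E)) (hu' : -u ∉ C)
    (x : E) (r : ℝ) : heightAlong u K x ≤ r ↔ x + r • u ∈ K := by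
  obtain ⟨m, hm⟩ := C.exists_le_of_add_smul_mem hu' x
  have hbdd : BddBelow {r : ℝ | x + r • u ∈ K} := ⟨m, fun r hr => hm r (hK.subset hr)⟩
  have hne : {r : ℝ | x + r • u ∈ K}.Nonempty := by
    obtain ⟨k, hk⟩ := hK.nonempty
    obtain ⟨r, hr⟩ := C.exists_add_smul_mem hu (x - k)
    refine ⟨r, ?_⟩
    have := hK.add_mem k hk _ hr
    rwa [show k + (x - k + r • u) = x + r • u by abel] at this
  have hcl : IsClosed {r : ℝ | x + r • u ∈ K} :=
    hK.isClosed.preimage (f := fun r : ℝ => x + r • u) (by fun_prop)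
  refine ⟨fun h => ?_, fun h => csInf_le hbdd h⟩
  have hmem : x + heightAlong u K x • u ∈ K := hcl.csInf_mem hne hbdd
  have := hK.add_mem _ hmem _ (C.smul_mem (interior_subset hu) (sub_nonneg.2 h))
  rwa [show x + heightAlong u K x • u + (r - heightAlong u K x) • u = x + r • u by module] at this

lemma heightAlong_nonpos_iff (hK : IsConeStable C K) (hu : u ∈ interior (C : Set E))
    (hu' : -u ∉ C) (x : E) : heightAlong u K x ≤ 0 ↔ x ∈ K := by
  rw [hK.heightAlong_le_iff hu hu', zero_smul, add_zero]

lemma add_heightAlong_mem (hK : IsConeStable C K) (hu : u ∈ interior (C : Set E))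
    (hu' : -u ∉ C) (x : E) : x + heightAlong u K x • u ∈ K :=
  (hK.heightAlong_le_iff hu hu' x _).1 le_rfl

lemma heightAlong_add_smul (hK : IsConeStable C K) (hu : u ∈ interior (C : Set E))
    (hu' : -u ∉ C) (x : E) (s : ℝ) : heightAlong u K (x + s • u) = heightAlong u K x - s := by
  refine eq_of_forall_ge_iff fun r => ?_
  rw [hK.heightAlong_le_iff hu hu', sub_le_iff_le_add, hK.heightAlong_le_iff hu hu',
    show x + s • u + r • u = x + (r + s) • u by module]

lemma convexOn_heightAlong (hK : IsConeStable C K) (hu : u ∈ interior (C : Set E))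
    (hu' : -u ∉ C) : ConvexOn ℝ Set.univ (heightAlong u K) := by
  refine ⟨convex_univ, fun x _ y _ a b ha hb hab => ?_⟩
  rw [hK.heightAlong_le_iff hu hu']
  have := hK.convex (hK.add_heightAlong_mem hu hu' x) (hK.add_heightAlong_mem hu hu' y) ha hb hab
  simp only [smul_eq_mul]
  convert this using 1
  module

lemma continuous_heightAlong [FiniteDimensional ℝ E] (hK : IsConeStable C K)
    (hu : u ∈ interior (C : Set E)) (hu' : -u ∉ C) : Continuous (heightAlong u K) :=
  (hK.convexOn_heightAlong hu hu').locallyLipschitz.continuous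

lemma heightAlong_cone_le (hK : IsConeStable C K) (hu : u ∈ interior (C : Set E))
    (hu' : -u ∉ C) (x : E) : heightAlong u (C : Set E) x ≤ heightAlong u K x :=
  (C.isConeStable.heightAlong_le_iff hu hu' x _).2 (hK.subset (hK.add_heightAlong_mem hu hu' x))

end IsConeStable

/-! ### Minkowski combinations against weighted sums of heights. -/

namespace IsConeStable

variable {C : ProperCone ℝ E} {K K₀ K₁ : Set E} {u : E}

lemma sdiff_eq_setOf_heightAlong (hK : IsConeStable C K) (hu : u ∈ interior (C : Set E))
    (hu' : -u ∉ C) : (C : Set E) \ K =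
      {x | heightAlong u (C : Set E) x ≤ 0 ∧ 0 < heightAlong u K x} := by
  ext x
  rw [Set.mem_sdiff, Set.mem_ofPred_eq, ← not_le, hK.heightAlong_nonpos_iff hu hu',
    C.isConeStable.heightAlong_nonpos_iff hu hu']

lemma sdiff_combination_subset (h₀ : IsConeStable C K₀) (h₁ : IsConeStable C K₁)
    (hu : u ∈ interior (C : Set E)) (hu' : -u ∉ C) {t : ℝ} :
    (C : Set E) \ ((1 - t) • K₀ + t • K₁) ⊆ {x | heightAlong u (C : Set E) x ≤ 0 ∧
      0 < (1 - t) * heightAlong u K₀ x + t * heightAlong u K₁ x} := by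
  rintro x ⟨hxC, hx⟩
  refine ⟨(C.isConeStable.heightAlong_nonpos_iff hu hu' x).2 hxC, ?_⟩
  by_contra! hle
  refine hx ?_
  set s := (1 - t) * heightAlong u K₀ x + t * heightAlong u K₁ x with hs
  -- As `s ≤ 0`, these points lie at or beyond the entry into `L`, and their weighted shifts along
  -- `u` cancel.
  have hmem : ∀ {L : Set E}, IsConeStable C L → x + (heightAlong u L x - s) • u ∈ L :=
    fun hL => (hL.heightAlong_le_iff hu hu' x _).1 (by linarith)
  refine ⟨_, Set.smul_mem_smul_set (hmem h₀), _, Set.smul_mem_smul_set (hmem h₁), ?_⟩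
  have e : (1 - t) * (heightAlong u K₀ x - s) + t * (heightAlong u K₁ x - s) = 0 := by
    rw [hs]; ring
  calc (1 - t) • (x + (heightAlong u K₀ x - s) • u) + t • (x + (heightAlong u K₁ x - s) • u)
      = x + ((1 - t) * (heightAlong u K₀ x - s) + t * (heightAlong u K₁ x - s)) • u := by module
    _ = x := by rw [e, zero_smul, add_zero]

lemma combination_add_mem (h₀ : IsConeStable C K₀) (h₁ : IsConeStable C K₁) {t : ℝ} {x c : E}
    (hx : x ∈ (1 - t) • K₀ + t • K₁) (hc : c ∈ C) : x + c ∈ (1 - t) • K₀ + t • K₁ := by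
  obtain ⟨_, ⟨a, ha, rfl⟩, _, ⟨b, hb, rfl⟩, rfl⟩ := hx
  refine ⟨_, Set.smul_mem_smul_set (h₀.add_mem a ha c hc), _,
    Set.smul_mem_smul_set (h₁.add_mem b hb c hc), ?_⟩
  module

section Measure

variable [FiniteDimensional ℝ E] [MeasurableSpace E] [BorelSpace E] (μ : Measure E)

lemma le_combination_of_measure_le [μ.IsAddHaarMeasure] (h₀ : IsConeStable C K₀)
    (h₁ : IsConeStable C K₁) (hu : u ∈ interior (C : Set E)) (hu' : -u ∉ C) {t : ℝ}
    (ht₀ : 0 < t) (ht₁ : t < 1)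
    (hfin : μ {x | heightAlong u (C : Set E) x ≤ 0 ∧
      0 < (1 - t) * heightAlong u K₀ x + t * heightAlong u K₁ x} ≠ ⊤)
    (hle : μ {x | heightAlong u (C : Set E) x ≤ 0 ∧
      0 < (1 - t) * heightAlong u K₀ x + t * heightAlong u K₁ x}
        ≤ μ ((C : Set E) \ ((1 - t) • K₀ + t • K₁))) (a b : E) :
    (1 - t) * heightAlong u K₀ ((1 - t) • a + t • b)
      + t * heightAlong u K₁ ((1 - t) • a + t • b)
      ≤ (1 - t) * heightAlong u K₀ a + t * heightAlong u K₁ b := by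
  by_contra! hlt
  set F : E → ℝ := fun x => (1 - t) * heightAlong u K₀ x + t * heightAlong u K₁ x with hF
  have hFc : Continuous F := ((h₀.continuous_heightAlong hu hu').const_mul _).add
    ((h₁.continuous_heightAlong hu hu').const_mul _)
  have hFs : ∀ x s, F (x + s • u) = F x - s := by
    intro x s
    simp only [hF, h₀.heightAlong_add_smul hu hu', h₁.heightAlong_add_smul hu hu']
    ring
  have hCc := C.isConeStable.continuous_heightAlong hu hu'
  set x₀ := (1 - t) • (a + heightAlong u K₀ a • u) + t • (b + heightAlong u K₁ b • u) with hx₀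
  have hx₀K : x₀ ∈ (1 - t) • K₀ + t • K₁ :=
    ⟨_, Set.smul_mem_smul_set (h₀.add_heightAlong_mem hu hu' a), _,
      Set.smul_mem_smul_set (h₁.add_heightAlong_mem hu hu' b), rfl⟩
  have hx₀C : x₀ ∈ C := AddMemClass.add_mem
    (C.smul_mem (h₀.subset (h₀.add_heightAlong_mem hu hu' a)) (sub_pos.2 ht₁).le)
    (C.smul_mem (h₁.subset (h₁.add_heightAlong_mem hu hu' b)) ht₀.le)
  have hFx₀ : 0 < F x₀ := by
    have e : x₀ = ((1 - t) • a + t • b)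
        + ((1 - t) * heightAlong u K₀ a + t * heightAlong u K₁ b) • u := by
      rw [hx₀]; module
    rw [e, hFs]
    exact sub_pos.2 hlt
  -- A strict failure at `a, b` puts `x₀` in the combination with `F x₀ > 0`. Then `U ⊆ x₀ + C` is a
  -- nonempty open set counted by the bound but missing from the complement, so the measures differ.
  let U : Set E := {x | 0 < F x} ∩ {x | heightAlong u (C : Set E) (x - x₀) < 0}
  have hUo : IsOpen U := (isOpen_lt continuous_const hFc).inter
    (isOpen_lt (hCc.comp (continuous_id.sub continuous_const)) continuous_const)
  have hUne : U.Nonempty := by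
    refine ⟨x₀ + (F x₀ / 2) • u, ?_, ?_⟩
    · change 0 < F _
      rw [hFs]
      linarith
    · change heightAlong u (C : Set E) _ < 0
      have h0 := (C.isConeStable.heightAlong_nonpos_iff hu hu' 0).2 C.zero_mem
      have := C.isConeStable.heightAlong_add_smul hu hu' 0 (F x₀ / 2)
      rw [zero_add] at this
      rw [add_sub_cancel_left, this]
      linarith
  have hUC : ∀ x ∈ U, x - x₀ ∈ C := fun x hx =>
    (C.isConeStable.heightAlong_nonpos_iff hu hu' _).1 hx.2.le
  have hUB : U ⊆ {x | heightAlong u (C : Set E) x ≤ 0 ∧ 0 < F x} := by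
    refine fun x hx => ⟨(C.isConeStable.heightAlong_nonpos_iff hu hu' x).2 ?_, hx.1⟩
    have := AddMemClass.add_mem hx₀C (hUC x hx)
    rwa [add_sub_cancel] at this
  have hsub : (C : Set E) \ ((1 - t) • K₀ + t • K₁) ⊆
      {x | heightAlong u (C : Set E) x ≤ 0 ∧ 0 < F x} \ U := by
    refine fun x hx => ⟨h₀.sdiff_combination_subset h₁ hu hu' hx, fun hxU => hx.2 ?_⟩
    have := h₀.combination_add_mem h₁ hx₀K (hUC x hxU)
    rwa [add_sub_cancel] at this
  have hlt' : μ ({x | heightAlong u (C : Set E) x ≤ 0 ∧ 0 < F x} \ U)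
      < μ {x | heightAlong u (C : Set E) x ≤ 0 ∧ 0 < F x} := by
    rw [measure_sdiff hUB hUo.measurableSet.nullMeasurableSet
      (measure_ne_top_of_subset hUB hfin)]
    refine ENNReal.sub_lt_self hfin (fun h0 => ?_) (hUo.measure_pos μ hUne).ne'
    exact (hUo.measure_pos μ hUne).not_ge ((measure_mono hUB).trans h0.le)
  exact (hle.trans (measure_mono hsub)).not_gt hlt'

end Measure

end IsConeStable

/-! ### Volumes as integrals of height differences. -/

section Slices

variable [MeasurableSpace E] [BorelSpace E] {μ : Measure E} {W : Submodule ℝ E} {ν : Measure W}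
  {u : E}

lemma measure_setOf_nonpos_and_pos_eq_lintegral
    (hμ : ∀ s, MeasurableSet s → μ s = ∫⁻ y : W, volume {r : ℝ | (y : E) + r • u ∈ s} ∂ν)
    {h F : E → ℝ} (hh : Continuous h) (hF : Continuous F)
    (hhu : ∀ x s, h (x + s • u) = h x - s) (hFu : ∀ x s, F (x + s • u) = F x - s) :
    μ {x | h x ≤ 0 ∧ 0 < F x} = ∫⁻ y : W, ENNReal.ofReal (F y - h y) ∂ν := by
  have hmeas : MeasurableSet {x | h x ≤ 0 ∧ 0 < F x} :=
    (measurableSet_le hh.measurable measurable_const).inter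
      (measurableSet_lt measurable_const hF.measurable)
  rw [hμ _ hmeas]
  refine lintegral_congr fun y => ?_
  rw [← Real.volume_Ico]
  congr 1
  ext r
  simp only [Set.mem_ofPred_eq, Set.mem_Ico, hhu, hFu, sub_nonpos, sub_pos]

end Slices

namespace IsConeStable

variable {C : ProperCone ℝ E} {K K₀ K₁ : Set E} {u : E}
  [FiniteDimensional ℝ E] [MeasurableSpace E] [BorelSpace E] {μ : Measure E}
  {W : Submodule ℝ E} {ν : Measure W}

lemma measure_sdiff_eq_lintegral (hK : IsConeStable C K)
    (hμ : ∀ s, MeasurableSet s → μ s = ∫⁻ y : W, volume {r : ℝ | (y : E) + r • u ∈ s} ∂ν)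
    (hu : u ∈ interior (C : Set E)) (hu' : -u ∉ C) :
    μ ((C : Set E) \ K)
      = ∫⁻ y : W, ENNReal.ofReal (heightAlong u K y - heightAlong u (C : Set E) y) ∂ν := by
  rw [hK.sdiff_eq_setOf_heightAlong hu hu']
  exact measure_setOf_nonpos_and_pos_eq_lintegral hμ
    (C.isConeStable.continuous_heightAlong hu hu') (hK.continuous_heightAlong hu hu')
    (C.isConeStable.heightAlong_add_smul hu hu') (hK.heightAlong_add_smul hu hu')

lemma measure_setOf_combination_eq (h₀ : IsConeStable C K₀) (h₁ : IsConeStable C K₁)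
    (hμ : ∀ s, MeasurableSet s → μ s = ∫⁻ y : W, volume {r : ℝ | (y : E) + r • u ∈ s} ∂ν)
    (hu : u ∈ interior (C : Set E)) (hu' : -u ∉ C) {t : ℝ} (ht₀ : 0 ≤ t) (ht₁ : t ≤ 1) :
    μ {x | heightAlong u (C : Set E) x ≤ 0 ∧
      0 < (1 - t) * heightAlong u K₀ x + t * heightAlong u K₁ x}
      = ENNReal.ofReal (1 - t) * μ ((C : Set E) \ K₀)
        + ENNReal.ofReal t * μ ((C : Set E) \ K₁) := by
  have hC := C.isConeStable.continuous_heightAlong hu hu'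
  have hc₀ := h₀.continuous_heightAlong hu hu'
  have hc₁ := h₁.continuous_heightAlong hu hu'
  have hm : ∀ {f : E → ℝ}, Continuous f →
      Measurable fun y : W => ENNReal.ofReal (f y - heightAlong u (C : Set E) y) :=
    fun hf => ((hf.sub hC).comp continuous_subtype_val).measurable.ennreal_ofReal
  rw [measure_setOf_nonpos_and_pos_eq_lintegral hμ
      (F := fun x => (1 - t) * heightAlong u K₀ x + t * heightAlong u K₁ x) hC
      ((hc₀.const_mul _).add (hc₁.const_mul _)) (C.isConeStable.heightAlong_add_smul hu hu')
      (fun x s => by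
        rw [h₀.heightAlong_add_smul hu hu', h₁.heightAlong_add_smul hu hu']; ring),
    h₀.measure_sdiff_eq_lintegral hμ hu hu', h₁.measure_sdiff_eq_lintegral hμ hu hu',
    ← lintegral_const_mul _ (hm hc₀), ← lintegral_const_mul _ (hm hc₁),
    ← lintegral_add_left ((hm hc₀).const_mul _)]
  refine lintegral_congr fun y => ?_
  have d₀ := sub_nonneg.2 (h₀.heightAlong_cone_le hu hu' (y : E))
  have d₁ := sub_nonneg.2 (h₁.heightAlong_cone_le hu hu' (y : E))
  rw [← ENNReal.ofReal_mul (sub_nonneg.2 ht₁), ← ENNReal.ofReal_mul ht₀,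
    ← ENNReal.ofReal_add (mul_nonneg (sub_nonneg.2 ht₁) d₀) (mul_nonneg ht₀ d₁)]
  congr 1
  ring

/-- Since `h_{K₁} ≥ h_C`, a positive `d` would give `C \ K₀` volume at least `d * ν W = ⊤`.
Dimension at least 2 enters here, through `Nontrivial W`. -/
lemma nonpos_of_heightAlong_eq_add [ν.IsAddHaarMeasure] [Nontrivial W] (h₀ : IsConeStable C K₀)
    (h₁ : IsConeStable C K₁)
    (hμ : ∀ s, MeasurableSet s → μ s = ∫⁻ y : W, volume {r : ℝ | (y : E) + r • u ∈ s} ∂ν)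
    (hu : u ∈ interior (C : Set E)) (hu' : -u ∉ C) (hfin : μ ((C : Set E) \ K₀) ≠ ⊤) {d : ℝ}
    (hd : ∀ x, heightAlong u K₀ x = heightAlong u K₁ x + d) : d ≤ 0 := by
  by_contra! hpos
  refine hfin (top_le_iff.1 ?_)
  have : NoncompactSpace W := RealNormedSpace.noncompactSpace W
  rw [h₀.measure_sdiff_eq_lintegral hμ hu hu']
  calc (⊤ : ENNReal) = ∫⁻ _ : W, ENNReal.ofReal d ∂ν := by
        rw [lintegral_const, measure_univ_of_isAddLeftInvariant,
          ENNReal.mul_top (ENNReal.ofReal_pos.2 hpos).ne']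
    _ ≤ _ := by
        refine lintegral_mono fun y => ENNReal.ofReal_le_ofReal ?_
        linarith [hd y, h₁.heightAlong_cone_le hu hu' (y : E)]

/-- The volume of the complement in a pointed cone is convex along Minkowski combinations of
closed convex sets stable under the cone, strictly so between different sets. -/
theorem measure_sdiff_combination [μ.IsAddHaarMeasure] (hdim : 2 ≤ finrank ℝ E)
    (hpointed : ∀ x ∈ C, -x ∈ C → x = 0) (hint : (interior (C : Set E)).Nonempty)
    (h₀ : IsConeStable C K₀) (h₁ : IsConeStable C K₁)
    (hfin₀ : μ ((C : Set E) \ K₀) ≠ ⊤) (hfin₁ : μ ((C : Set E) \ K₁) ≠ ⊤) {t : ℝ}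
    (ht₀ : 0 < t) (ht₁ : t < 1) :
    μ ((C : Set E) \ ((1 - t) • K₀ + t • K₁)) ≤ ENNReal.ofReal (1 - t) * μ ((C : Set E) \ K₀)
        + ENNReal.ofReal t * μ ((C : Set E) \ K₁) ∧
      (μ ((C : Set E) \ ((1 - t) • K₀ + t • K₁)) = ENNReal.ofReal (1 - t) * μ ((C : Set E) \ K₀)
        + ENNReal.ofReal t * μ ((C : Set E) \ K₁) ↔ K₀ = K₁) := by
  have : Nontrivial E := Module.nontrivial_of_finrank_pos (R := ℝ) (by omega)
  obtain ⟨u, hu, hu0⟩ : ∃ u ∈ interior (C : Set E), u ≠ 0 := by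
    have := (isOpen_interior (s := (C : Set E))).measure_pos μ hint
    by_contra! h
    exact this.ne' (measure_mono_null (fun x hx => h x hx) (measure_singleton (0 : E)))
  have hu' : -u ∉ C := fun h => hu0 (hpointed u (interior_subset hu) h)
  obtain ⟨W, ν, hν, hW, hμ⟩ := μ.exists_addHaar_eq_lintegral_line hu0
  have hWn : Nontrivial W := Module.nontrivial_of_finrank_pos (R := ℝ) (by omega)
  have hB := h₀.measure_setOf_combination_eq h₁ hμ hu hu' ht₀.le ht₁.le
  rw [← hB]
  refine ⟨measure_mono (h₀.sdiff_combination_subset h₁ hu hu'), fun heq => ?_, ?_⟩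
  · have hBfin : μ {x | heightAlong u (C : Set E) x ≤ 0 ∧
        0 < (1 - t) * heightAlong u K₀ x + t * heightAlong u K₁ x} ≠ ⊤ := by
      rw [hB]
      finiteness
    have hcomb := h₀.le_combination_of_measure_le μ h₁ hu hu' ht₀ ht₁ hBfin heq.ge
    have hconst := (h₀.convexOn_heightAlong hu hu').sub_eq_sub_of_le_combination
      (h₁.convexOn_heightAlong hu hu') (h₁.continuous_heightAlong hu hu') ht₀ ht₁ hcomb
    set d := heightAlong u K₀ 0 - heightAlong u K₁ 0
    have hd : ∀ x, heightAlong u K₀ x - heightAlong u K₁ x = d := fun x => hconst x 0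
    have hle := h₀.nonpos_of_heightAlong_eq_add h₁ hμ hu hu' hfin₀ (d := d)
      (fun x => by linarith [hd x])
    have hge := h₁.nonpos_of_heightAlong_eq_add h₀ hμ hu hu' hfin₁ (d := -d)
      (fun x => by linarith [hd x])
    ext x
    rw [← h₀.heightAlong_nonpos_iff hu hu', ← h₁.heightAlong_nonpos_iff hu hu',
      show heightAlong u K₀ x = heightAlong u K₁ x by linarith [hd x]]
  · rintro rfl
    rw [hB, ← h₀.convex.add_smul (sub_pos.2 ht₁).le ht₀.le, ← add_mul,
      ← ENNReal.ofReal_add (sub_pos.2 ht₁).le ht₀.le]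
    simp

end IsConeStable

end ConeStable

/-! ### Scaling and the Brunn–Minkowski form. -/

lemma Real.pow_mul_rpow_one_div {n : ℕ} (hn : n ≠ 0) {M v : ℝ} (hM : 0 ≤ M) (hv : 0 ≤ v) :
    (M ^ n * v) ^ (1 / (n : ℝ)) = M * v ^ (1 / (n : ℝ)) := by
  rw [Real.mul_rpow (pow_nonneg hM n) hv, one_div, Real.pow_rpow_inv_natCast hM hn]

section Coconvex

variable {n : ℕ} {C : ProperCone ℝ (EuclideanSpace ℝ (Fin n))}
  {A K K₀ K₁ : Set (EuclideanSpace ℝ (Fin n))}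

lemma IsCoconvex.exists_isConeStable [NeZero n]
    (hint : (interior (C : Set (EuclideanSpace ℝ (Fin n)))).Nonempty) (hA : IsCoconvex C A) :
    ∃ K, IsConeStable C K ∧ A = (C : Set (EuclideanSpace ℝ (Fin n))) \ K := by
  obtain ⟨⟨K, hsub, hcl, hconv, rfl⟩, -, hfin⟩ := hA
  have : Nontrivial (EuclideanSpace ℝ (Fin n)) :=
    Module.nontrivial_of_finrank_pos (R := ℝ) (by simpa using Nat.pos_of_neZero n)
  exact ⟨K, .of_measure_sdiff_lt_top volume hint hsub hcl hconv hfin, rfl⟩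

lemma sdiff_smul_eq_smul_sdiff {a : ℝ} (ha : 0 < a) (K : Set (EuclideanSpace ℝ (Fin n))) :
    (C : Set (EuclideanSpace ℝ (Fin n))) \ (a • K) = a • ((C : Set _) \ K) := by
  rw [Set.smul_set_sdiff₀ ha.ne', C.smul_set_eq ha]

lemma cosum_smul_sdiff (h₀ : K₀ ⊆ C) (h₁ : K₁ ⊆ C) {a b : ℝ} (ha : 0 < a) (hb : 0 < b) :
    cosum C (a • ((C : Set (EuclideanSpace ℝ (Fin n))) \ K₀))
      (b • ((C : Set (EuclideanSpace ℝ (Fin n))) \ K₁)) =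
      (C : Set (EuclideanSpace ℝ (Fin n))) \ (a • K₀ + b • K₁) := by
  have aux : ∀ {c : ℝ} {K : Set (EuclideanSpace ℝ (Fin n))}, 0 < c → K ⊆ C →
      (C : Set (EuclideanSpace ℝ (Fin n))) \ (c • ((C : Set (EuclideanSpace ℝ (Fin n))) \ K))
        = c • K := by
    intro c K hc hK
    rw [sdiff_smul_eq_smul_sdiff hc, Set.sdiff_sdiff_cancel_left hK]
  rw [cosum, aux ha h₀, aux hb h₁]

lemma volume_smul_eq_ofReal_pow_mul {a : ℝ} (ha : 0 ≤ a) (S : Set (EuclideanSpace ℝ (Fin n))) :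
    volume (a • S) = ENNReal.ofReal (a ^ n) * volume S := by
  rw [Measure.addHaar_smul, finrank_euclideanSpace_fin, abs_of_nonneg (pow_nonneg ha n)]

lemma volume_real_smul_eq_pow_mul {a : ℝ} (ha : 0 ≤ a) (S : Set (EuclideanSpace ℝ (Fin n))) :
    volume.real (a • S) = a ^ n * volume.real S := by
  rw [measureReal_def, volume_smul_eq_ofReal_pow_mul ha, ENNReal.toReal_mul,
    ENNReal.toReal_ofReal (pow_nonneg ha n), measureReal_def]

lemma volume_sdiff_inv_rpow_smul_eq_one (hn : n ≠ 0)
    (hpos : 0 < volume ((C : Set (EuclideanSpace ℝ (Fin n))) \ K))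
    (hfin : volume ((C : Set (EuclideanSpace ℝ (Fin n))) \ K) < ⊤) :
    volume ((C : Set (EuclideanSpace ℝ (Fin n))) \
      ((volume.real ((C : Set (EuclideanSpace ℝ (Fin n))) \ K) ^ (1 / (n : ℝ)))⁻¹ • K)) = 1 := by
  have hV : 0 < volume.real ((C : Set (EuclideanSpace ℝ (Fin n))) \ K) :=
    ENNReal.toReal_pos hpos.ne' hfin.ne
  have ha := inv_pos.2 (Real.rpow_pos_of_pos hV (1 / (n : ℝ)))
  rw [sdiff_smul_eq_smul_sdiff ha, volume_smul_eq_ofReal_pow_mul ha.le, inv_pow, one_div,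
    Real.rpow_inv_natCast_pow hV.le hn, ENNReal.ofReal_inv_of_pos hV, measureReal_def,
    ENNReal.ofReal_toReal hfin.ne, ENNReal.inv_mul_cancel hpos.ne' hfin.ne]

end Coconvex

theorem theorem1 (n : ℕ) (hn : 2 ≤ n)
    (C : ProperCone ℝ (EuclideanSpace ℝ (Fin n)))
    (hpointed : ∀ x ∈ C, -x ∈ C → x = 0)
    (hint : (interior (C : Set (EuclideanSpace ℝ (Fin n)))).Nonempty)
    (A₀ A₁ : Set (EuclideanSpace ℝ (Fin n)))
    (h₀ : IsCoconvex C A₀) (h₁ : IsCoconvex C A₁)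
    (t : ℝ) (ht₀ : 0 < t) (ht₁ : t < 1) :
    volume (cosum C ((1 - t) • A₀) (t • A₁)) < ⊤ ∧
    volume.real (cosum C ((1 - t) • A₀) (t • A₁)) ^ (1 / (n : ℝ)) ≤
      (1 - t) * volume.real A₀ ^ (1 / (n : ℝ)) + t * volume.real A₁ ^ (1 / (n : ℝ)) ∧
    (volume.real (cosum C ((1 - t) • A₀) (t • A₁)) ^ (1 / (n : ℝ)) =
      (1 - t) * volume.real A₀ ^ (1 / (n : ℝ)) + t * volume.real A₁ ^ (1 / (n : ℝ)) ↔
      ∃ α : ℝ, 0 < α ∧ A₀ = α • A₁) := by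
  have hn0 : n ≠ 0 := by omega
  have : NeZero n := ⟨hn0⟩
  have hs : 0 < 1 - t := sub_pos.2 ht₁
  obtain ⟨K₀, hK₀, rfl⟩ := h₀.exists_isConeStable hint
  obtain ⟨K₁, hK₁, rfl⟩ := h₁.exists_isConeStable hint
  obtain ⟨-, hpos₀, hfin₀⟩ := h₀
  obtain ⟨-, hpos₁, hfin₁⟩ := h₁
  rw [cosum_smul_sdiff hK₀.subset hK₁.subset hs ht₀]
  have hL₀ := volume_sdiff_inv_rpow_smul_eq_one hn0 hpos₀ hfin₀
  have hL₁ := volume_sdiff_inv_rpow_smul_eq_one hn0 hpos₁ hfin₁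
  set a₀ := volume.real ((C : Set (EuclideanSpace ℝ (Fin n))) \ K₀) ^ (1 / (n : ℝ)) with ha₀
  set a₁ := volume.real ((C : Set (EuclideanSpace ℝ (Fin n))) \ K₁) ^ (1 / (n : ℝ)) with ha₁
  have pos₀ : 0 < a₀ := Real.rpow_pos_of_pos (ENNReal.toReal_pos hpos₀.ne' hfin₀.ne) _
  have pos₁ : 0 < a₁ := Real.rpow_pos_of_pos (ENNReal.toReal_pos hpos₁.ne' hfin₁.ne) _
  set M := (1 - t) * a₀ + t * a₁ with hM
  have posM : 0 < M := by positivity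
  -- With this weight, `(1-t)K₀ + tK₁` is `M` times a convex combination of the normalised sets
  -- `a₀⁻¹ • K₀` and `a₁⁻¹ • K₁`.
  set θ := t * a₁ / M with hθ
  have hθ₀ : 0 < θ := by positivity
  have hθ' : 1 - θ = (1 - t) * a₀ / M := by
    rw [hθ, eq_div_iff posM.ne', sub_mul, div_mul_cancel₀ _ posM.ne', hM]
    ring
  have hθ₁ : θ < 1 := by
    rw [← sub_pos, hθ']
    positivity
  obtain ⟨hle, heq⟩ := IsConeStable.measure_sdiff_combination (μ := volume)
    (by rwa [finrank_euclideanSpace_fin]) hpointed hint (hK₀.smul (inv_pos.2 pos₀))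
    (hK₁.smul (inv_pos.2 pos₁)) (by rw [hL₀]; simp) (by rw [hL₁]; simp) hθ₀ hθ₁
  rw [hL₀, hL₁, mul_one, mul_one, ← ENNReal.ofReal_add (sub_pos.2 hθ₁).le hθ₀.le,
    sub_add_cancel, ENNReal.ofReal_one] at hle heq
  have hK : (1 - t) • K₀ + t • K₁ = M • ((1 - θ) • a₀⁻¹ • K₀ + θ • a₁⁻¹ • K₁) := by
    rw [smul_add, smul_smul, smul_smul, smul_smul, smul_smul]
    congr 2
    · rw [hθ']; field_simp
    · rw [hθ]; field_simp
  rw [hK, sdiff_smul_eq_smul_sdiff posM, volume_real_smul_eq_pow_mul posM.le,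
    volume_smul_eq_ofReal_pow_mul posM.le,
    Real.pow_mul_rpow_one_div hn0 posM.le measureReal_nonneg]
  have hfin := hle.trans_lt ENNReal.one_lt_top
  set D := (C : Set (EuclideanSpace ℝ (Fin n))) \ ((1 - θ) • a₀⁻¹ • K₀ + θ • a₁⁻¹ • K₁)
  have hD : volume.real D ≤ 1 := ENNReal.toReal_le_of_le_ofReal zero_le_one (by simpa using hle)
  refine ⟨ENNReal.mul_lt_top ENNReal.ofReal_lt_top hfin,
    mul_le_of_le_one_right posM.le (Real.rpow_le_one measureReal_nonneg hD (by positivity)), ?_⟩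
  rw [mul_eq_left₀ posM.ne', one_div, Real.rpow_inv_eq measureReal_nonneg zero_le_one
    (Nat.cast_ne_zero.2 hn0), Real.one_rpow, measureReal_def,
    ENNReal.toReal_eq_one_iff, heq]
  -- Equality now reads `a₀⁻¹ • K₀ = a₁⁻¹ • K₁`, so the dilation factor is `a₀ / a₁`.
  constructor
  · intro h
    refine ⟨a₀ / a₁, div_pos pos₀ pos₁, ?_⟩
    rw [← sdiff_smul_eq_smul_sdiff (div_pos pos₀ pos₁), div_eq_mul_inv, mul_smul, ← h,
      smul_inv_smul₀ pos₀.ne']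
  · rintro ⟨α, hα, h⟩
    have haα : a₀ = α * a₁ := by
      rw [ha₀, h, volume_real_smul_eq_pow_mul hα.le,
        Real.pow_mul_rpow_one_div hn0 hα.le measureReal_nonneg]
    have hKα : K₀ = α • K₁ := by
      rw [← sdiff_smul_eq_smul_sdiff hα] at h
      rw [← Set.sdiff_sdiff_cancel_left hK₀.subset, h,
        Set.sdiff_sdiff_cancel_left (hK₁.smul hα).subset]
    rw [hKα, haα, smul_smul]
    congr 1
    field_simp
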